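/- For $d\in\mathbb N$ and $z=(x,\xi)\in\mathbb R^{2d}=\mathbb R^d\times\mathbb R^d$ write $\langle z\rangle=(1+|x|^2+|\xi|^2)^{1/2}$, and let $B_r(z_0)$ be the open Euclidean ball of radius $r$ centred at $z_0$. For $f:\mathbb R^d\to\mathbb C$ put $T_xf(y)=f(y-x)$ and $M_\xi f(y)=e^{iy\cdot\xi}f(y)$. For $a\in C_c^\infty(\mathbb R^{2d})$, $h>0$ and a Schwartz function $u$ on $\mathbb R^d$ define the Weyl quantization of the dilated symbol $a_h(z)=a(hz)$ by $$a^w(hy,hD_y)u(y)=(2\pi)^{-d}\int_{\mathbb R^{2d}}e^{i(y-w)\cdot\eta}\,a\Big(h\,\frac{y+w}{2},\,h\eta\Big)\,u(w)\,\mathrm dw\,\mathrm d\eta .$$ Let $\varphi(y)=e^{-|y|^2/2}$ for $y\in\mathbb R^d$, let $(x_0,\xi_0)\in\mathbb R^{2d}$ and $\varepsilon>0$, and let $a\in C_c^\infty(\mathbb R^{2d})$ be complex-valued with $\operatorname{supp}(a)\subseteq B_{\varepsilon/4}(x_0,\xi_0)$. Then for every $N\in\mathbb N$ (including $N=0$)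 there is a constant $C_N>0$ such that, for all $(x,\xi)\in\mathbb R^{2d}$ with $|x-x_0|^2+|\xi-\xi_0|^2\ge\varepsilon^2$ and all $h\in(0,1]$, the function $a^w(hy,hD_y)(T_{x/h}M_{\xi/h}\varphi)$ belongs to $L^2(\mathbb R^d)$ and $$\big\|a^w(hy,hD_y)\big(T_{x/h}M_{\xi/h}\varphi\big)\big\|_{L^2(\mathbb R^d)}^2\le C_N\,h^{2N}\,\langle(x,\xi)\rangle^{-N}.$$ Here $C_N$ may depend on $d,a,x_0,\xi_0,\varepsilon,N$, but not on $(x,\xi)$ or $h$. -/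

import Mathlib

open MeasureTheory
open scoped ContDiff

namespace PhaseSpace

/-- The configuration space `ℝᵈ` with its Euclidean norm. -/
abbrev Rd (d : ℕ) : Type := EuclideanSpace ℝ (Fin d)

variable {d : ℕ}

/-- The open Euclidean ball of radius `r` and centre `(x₀, ξ₀)` in `ℝ²ᵈ = ℝᵈ × ℝᵈ`. It is written
out because the product type `Rd d × Rd d` carries the sup metric; the topology and the notions of
smoothness and of support do not depend on this choice. -/
def ball (r : ℝ) (x₀ ξ₀ : Rd d) : Set (Rd d × Rd d) :=
  {p | Real.sqrt (‖p.1 - x₀‖ ^ 2 + ‖p.2 - ξ₀‖ ^ 2) < r}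

/-- The Japanese bracket `⟨(x, ξ)⟩ = (1 + |x|² + |ξ|²)^{1/2}` on `ℝ²ᵈ`. -/
noncomputable def bracket (x ξ : Rd d) : ℝ :=
  Real.sqrt (1 + (‖x‖ ^ 2 + ‖ξ‖ ^ 2))

/-- Translation: `(T_x f)(y) = f (y - x)`. -/
def translate (x : Rd d) (f : Rd d → ℂ) : Rd d → ℂ :=
  fun y => f (y - x)

/-- Modulation: `(M_ξ f)(y) = e^{i y · ξ} f y`. -/
noncomputable def modulate (ξ : Rd d) (f : Rd d → ℂ) : Rd d → ℂ :=
  fun y => Complex.exp (Complex.I * ((inner ℝ y ξ : ℝ) : ℂ)) * f y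

/-- The Gaussian `φ(y) = e^{-|y|²/2}`. -/
noncomputable def gaussian (d : ℕ) : Rd d → ℂ :=
  fun y => ((Real.exp (-‖y‖ ^ 2 / 2) : ℝ) : ℂ)

/-- The dilated symbol `a_h(z) = a(h z)`, `z ∈ ℝ²ᵈ`. -/
def dilate (h : ℝ) (a : Rd d × Rd d → ℂ) : Rd d × Rd d → ℂ :=
  fun p => a (h • p)

/-- The pseudodifferential operator `aᵗ(x, D)` in the `t`-quantization,
`aᵗ(x, D) u (x) = (2π)⁻ᵈ ∫_{ℝ²ᵈ} e^{i (x - y) · ξ} a (t x + (1 - t) y, ξ) u(y) dy dξ`.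
This formula is the definition when the integral converges absolutely, in particular for a
Schwartz function `u` and a symbol `a` that is smooth with compact support. -/
noncomputable def quantize (t : ℝ) (a : Rd d × Rd d → ℂ) (u : Rd d → ℂ) : Rd d → ℂ :=
  fun x => (((2 * Real.pi) ^ d : ℝ) : ℂ)⁻¹ *
    ∫ p : Rd d × Rd d,
      Complex.exp (Complex.I * ((inner ℝ (x - p.1) p.2 : ℝ) : ℂ)) *
        a (t • x + (1 - t) • p.1, p.2) * u p.1

/-- The Weyl quantization `a^w(x, D)`, the case `t = 1/2`. -/
noncomputable def weyl (a : Rd d × Rd d → ℂ) (u : Rd d → ℂ) : Rd d → ℂ :=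
  quantize (1 / 2) a u

end PhaseSpace

/-! ### Oscillatory integrals and derivative bounds -/

namespace PhaseSpace

/-! Centre phase space at the packet: with t = y − x/h, the value at y is, up to a phase and (2π)⁻ᵈ,
I(t) = ∫ e^{i(t−s)·θ} a(x + h(t+s)/2, ξ + hθ) φ(s) ds dθ (`norm_weyl_packet`). Two bounds on I are
multiplied.

Integrating in θ first gives rapid decay in t − s, hence in t because φ(s) absorbs powers of s; the
volume of the θ-support costs h⁻ᵈ (`one_add_norm_pow_mul_norm_integral_packetIntegrand_le`).

Integrating in s first gives rapid decay in θ. Where a does not vanish, the separation of packet and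
symbol forces ⟨(x,ξ)⟩/h ≤ c(1+|t|)(1+|s|)(1+|θ|) (`bracket_le_of_mem_ball`). So any power of
⟨(x,ξ)⟩/h is paid for by φ, by the decay in θ, and by the same power of 1+|t|
(`pow_mul_norm_integral_packetIntegrand_le`).

In the product, |I(t)|², the decay of the first bound covers the growth in t of the second, and d
extra powers of h from the second cancel h⁻ᵈ. What remains is integrable in t. -/

/-- The weight `(1 + |v|)⁻⁽ⁿ⁺¹⁾` is integrable on a space of dimension `n`. -/
theorem integrable_inv_one_add_norm_pow (d : ℕ) :
    Integrable (fun v : Rd d => ((1 + ‖v‖) ^ (d + 1))⁻¹) := by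
  have h := integrable_one_add_norm (E := Rd d) (μ := volume) (r := (d + 1 : ℕ))
    (by simp)
  refine h.congr (Filter.Eventually.of_forall fun v => ?_)
  simp only
  rw [Real.rpow_neg (by positivity), Real.rpow_natCast]

open FourierTransform in
/-- Rapid decay of an oscillatory integral with linear phase. -/
theorem one_add_norm_pow_mul_norm_integral_exp_le (d n : ℕ) :
    ∃ C : ℝ, 0 ≤ C ∧ ∀ f : Rd d → ℂ, ContDiff ℝ ∞ f → HasCompactSupport f →
      ∀ A : ℝ, (∀ j ≤ n, ∫ v, ‖iteratedFDeriv ℝ j f v‖ ≤ A) → ∀ w : Rd d,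
        (1 + ‖w‖) ^ n * ‖∫ v, Complex.exp (Complex.I * ((inner ℝ v w : ℝ) : ℂ)) * f v‖ ≤
          C * A := by
  refine ⟨2 ^ n * (1 + (2 * Real.pi) ^ n * (2 ^ n * (n + 1))), by positivity, ?_⟩
  intro f hf hfc A hA w
  set c : ℝ := 2 * Real.pi with hc
  have hc0 : 0 < c := by positivity
  -- The Fourier kernel of `𝓕` is e^{−2πi v·w}, hence the frequency −w/(2π).
  have hF : ∫ v, Complex.exp (Complex.I * ((inner ℝ v w : ℝ) : ℂ)) * f v =
      𝓕 f (-(c⁻¹ • w)) := by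
    rw [Real.fourier_eq']
    refine integral_congr_ae (Filter.Eventually.of_forall fun v => ?_)
    simp only [smul_eq_mul]
    congr 2
    rw [mul_comm, inner_neg_right, inner_smul_right]
    congr 2
    field_simp
    rw [hc]; ring
  have hint : ∀ k m : ℕ, Integrable (fun v => ‖v‖ ^ k * ‖iteratedFDeriv ℝ m f v‖) := by
    intro k m
    refine Continuous.integrable_of_hasCompactSupport ?_ ((hfc.iteratedFDeriv m).norm.mul_left)
    exact (continuous_norm.pow k).mul
      (hf.continuous_iteratedFDeriv (m := m) (by exact_mod_cast le_top)).norm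
  have key := fun m : ℕ => Real.pow_mul_norm_iteratedFDeriv_fourier_le (K := ⊤) (N := ⊤) hf
    (fun k m _ _ => hint k m) (k := 0) (n := m) le_top le_top (-(c⁻¹ • w))
  simp only [norm_iteratedFDeriv_zero, pow_zero, one_mul, norm_neg, norm_smul, norm_inv,
    Real.norm_of_nonneg hc0.le] at key
  rw [hF]
  set Z := ‖𝓕 f (-(c⁻¹ • w))‖ with hZ
  have hA0 : 0 ≤ A := le_trans (integral_nonneg fun v => norm_nonneg _) (hA 0 (Nat.zero_le _))
  have k0 : Z ≤ A := by
    have := key 0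
    simp at this
    refine this.trans ?_
    have := hA 0 (Nat.zero_le _)
    simpa using this
  have kn : ‖w‖ ^ n * Z ≤ c ^ n * (2 ^ n * ((n + 1) * A)) := by
    have h1 := key n
    have h2 : ∑ p ∈ Finset.range (0 + 1) ×ˢ Finset.range (n + 1),
        ∫ v, ‖v‖ ^ p.1 * ‖iteratedFDeriv ℝ p.2 f v‖ ≤ (n + 1) * A := by
      have : ∀ p ∈ Finset.range (0 + 1) ×ˢ Finset.range (n + 1),
          ∫ v, ‖v‖ ^ p.1 * ‖iteratedFDeriv ℝ p.2 f v‖ ≤ A := by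
        intro p hp
        simp only [zero_add, Finset.range_one, Finset.mem_product, Finset.mem_singleton,
          Finset.mem_range] at hp
        rw [hp.1]
        simpa using hA p.2 (by omega)
      refine (Finset.sum_le_card_nsmul _ _ _ this).trans ?_
      simp
    rw [mul_pow, inv_pow] at h1
    have h3 : ‖w‖ ^ n * Z = c ^ n * ((c ^ n)⁻¹ * ‖w‖ ^ n * Z) := by
      field_simp
    rw [h3]
    refine mul_le_mul_of_nonneg_left (h1.trans ?_) (by positivity)
    simp only [Nat.cast_zero, mul_zero, zero_add]
    exact mul_le_mul_of_nonneg_left h2 (by positivity)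
  have hadd : (1 + ‖w‖) ^ n ≤ 2 ^ n * (1 + ‖w‖ ^ n) := by
    have h1 : (1 + ‖w‖) ≤ 2 * max 1 ‖w‖ := by
      have := le_max_left 1 ‖w‖; have := le_max_right 1 ‖w‖; linarith
    refine (pow_le_pow_left₀ (by positivity) h1 n).trans ?_
    rw [mul_pow]
    gcongr
    rcases max_choice 1 ‖w‖ with h | h <;> rw [h]
    · simp
    · simp
  calc (1 + ‖w‖) ^ n * Z ≤ 2 ^ n * (1 + ‖w‖ ^ n) * Z := by gcongr
    _ = 2 ^ n * (Z + ‖w‖ ^ n * Z) := by ring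
    _ ≤ 2 ^ n * (A + c ^ n * (2 ^ n * ((n + 1) * A))) := by gcongr
    _ = _ := by ring

/-- The exponential series gives (1+r)^k ≤ k! e^{1+r}, and 1 + r − r²/2 ≤ 2. -/
theorem one_add_pow_mul_exp_le (k : ℕ) {r : ℝ} (hr : 0 ≤ r) :
    (1 + r) ^ k * Real.exp (-r ^ 2 / 2) ≤ k.factorial * Real.exp 2 := by
  have h := Real.pow_div_factorial_le_exp (1 + r) (by positivity) k
  rw [div_le_iff₀ (by positivity)] at h
  calc (1 + r) ^ k * Real.exp (-r ^ 2 / 2)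
      ≤ (Real.exp (1 + r) * k.factorial) * Real.exp (-r ^ 2 / 2) := by gcongr
    _ = k.factorial * Real.exp (1 + r + -r ^ 2 / 2) := by
        rw [Real.exp_add (1 + r)]; ring
    _ ≤ _ := by gcongr; nlinarith [sq_nonneg (r - 1)]

theorem contDiff_gaussian (d : ℕ) : ContDiff ℝ ∞ (gaussian d) := by
  unfold gaussian
  exact Complex.ofRealCLM.contDiff.comp
    (Real.contDiff_exp.comp (((contDiff_norm_sq ℝ).neg).div_const 2))

/-- All derivatives of the Gaussian decay rapidly. -/
theorem one_add_norm_pow_mul_norm_iteratedFDeriv_gaussian_le (d n k : ℕ) :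
    ∃ C : ℝ, 0 ≤ C ∧ ∀ j ≤ n, ∀ v : Rd d,
      (1 + ‖v‖) ^ k * ‖iteratedFDeriv ℝ j (gaussian d) v‖ ≤ C := by
  have hq : Function.HasTemperateGrowth (fun v : Rd d => (-1 / 2 : ℝ) * ‖v‖ ^ 2) :=
    (Function.HasTemperateGrowth.const _).mul (Function.hasTemperateGrowth_norm_sq (Rd d))
  obtain ⟨l, B, hB, hbound⟩ := hq.norm_iteratedFDeriv_le_uniform n
  refine ⟨n.factorial * (1 + B) ^ n * ((k + l * n).factorial * Real.exp 2), by positivity, ?_⟩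
  intro j hj v
  have hg : gaussian d = Complex.ofRealLI ∘ (Real.exp ∘ fun v : Rd d => (-1 / 2 : ℝ) * ‖v‖ ^ 2) := by
    funext v
    simp only [gaussian, Function.comp_apply, Complex.ofRealLI_apply]
    congr 2
    ring
  have hcd : ContDiff ℝ ∞ (Real.exp ∘ fun v : Rd d => (-1 / 2 : ℝ) * ‖v‖ ^ 2) :=
    Real.contDiff_exp.comp (contDiff_const.mul (contDiff_norm_sq ℝ))
  rw [hg, LinearIsometry.norm_iteratedFDeriv_comp_left (n := ∞) _ hcd.contDiffAt
    (by exact_mod_cast le_top)]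
  -- Faà di Bruno needs the i-th derivative of the exponent bounded by R^i; since R ≥ 1, one bound R
  -- for all i ≥ 1 suffices.
  set R : ℝ := (1 + B) * (1 + ‖v‖) ^ l with hR
  have hone : 1 ≤ (1 + ‖v‖) ^ l := one_le_pow₀ (by simp)
  have hR1 : 1 ≤ R := by nlinarith
  have h1 := norm_iteratedFDeriv_comp_le (𝕜 := ℝ) (N := ∞) Real.contDiff_exp
    (contDiff_const.mul (contDiff_norm_sq ℝ)) (n := j) (by exact_mod_cast le_top) v
    (f := fun v : Rd d => (-1 / 2 : ℝ) * ‖v‖ ^ 2)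
    (C := Real.exp (-‖v‖ ^ 2 / 2)) (D := R)
    (by
      intro i _
      rw [norm_iteratedFDeriv_eq_norm_iteratedDeriv, iteratedDeriv_eq_iterate,
        Real.iter_deriv_exp, Real.norm_of_nonneg (Real.exp_pos _).le]
      apply le_of_eq; congr 1; ring)
    (by
      intro i hi hij
      refine (hbound i (hij.trans hj) v).trans ?_
      refine le_trans ?_ (le_self_pow₀ hR1 (by omega))
      rw [hR]; gcongr; linarith)
  calc (1 + ‖v‖) ^ k * _ ≤ (1 + ‖v‖) ^ k * (j.factorial * Real.exp (-‖v‖ ^ 2 / 2) * R ^ j) := by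
        gcongr
    _ ≤ (1 + ‖v‖) ^ k * (n.factorial * Real.exp (-‖v‖ ^ 2 / 2) * R ^ n) := by
        have := Nat.factorial_le hj
        gcongr
    _ = n.factorial * (1 + B) ^ n * ((1 + ‖v‖) ^ (k + l * n) * Real.exp (-‖v‖ ^ 2 / 2)) := by
        rw [hR, mul_pow, ← pow_mul, pow_add]; ring
    _ ≤ _ := by
        exact mul_le_mul_of_nonneg_left (one_add_pow_mul_exp_le _ (norm_nonneg v))
          (by positivity)

/-- Composition with an affine contraction does not increase the norms of the derivatives. -/
theorem norm_iteratedFDeriv_comp_add_le {V E F : Type*} [NormedAddCommGroup V] [NormedSpace ℝ V]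
    [NormedAddCommGroup E] [NormedSpace ℝ E] [NormedAddCommGroup F] [NormedSpace ℝ F]
    {a : E → F} (ha : ContDiff ℝ ∞ a) (P : E) (T : V →L[ℝ] E) (hT : ‖T‖ ≤ 1) (j : ℕ) (v : V) :
    ‖iteratedFDeriv ℝ j (fun v => a (P + T v)) v‖ ≤ ‖iteratedFDeriv ℝ j a (P + T v)‖ := by
  have hb : ContDiff ℝ ∞ (fun z => a (P + z)) := ha.comp (contDiff_const.add contDiff_id)
  have h := T.iteratedFDeriv_comp_right hb v (i := j) (by exact_mod_cast le_top)
  rw [iteratedFDeriv_comp_add_left] at h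
  change iteratedFDeriv ℝ j (fun v => a (P + T v)) v = _ at h
  rw [h]
  refine (ContinuousMultilinearMap.norm_compContinuousLinearMap_le _ _).trans ?_
  simp only [Finset.prod_const]
  exact mul_le_of_le_one_right (norm_nonneg _) (pow_le_one₀ (norm_nonneg _) hT)

/-- Derivatives of a test function are bounded, with rapid decay. -/
theorem norm_iteratedFDeriv_le_of_hasCompactSupport {E F : Type*}
    [NormedAddCommGroup E] [NormedSpace ℝ E] [NormedAddCommGroup F] [NormedSpace ℝ F]
    {a : E → F} (ha : ContDiff ℝ ∞ a) (hac : HasCompactSupport a) (n k : ℕ) :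
    ∃ C : ℝ, 0 ≤ C ∧ ∀ j ≤ n, ∀ p, (1 + ‖p‖) ^ k * ‖iteratedFDeriv ℝ j a p‖ ≤ C := by
  refine ⟨_, ?_, fun j hj p => SchwartzMap.one_add_le_sup_seminorm_apply (𝕜 := ℝ)
    (m := (k, n)) le_rfl hj (hac.toSchwartzMap ha) p⟩
  positivity


theorem norm_exp_I_mul_ofReal (r : ℝ) : ‖Complex.exp (Complex.I * (r : ℂ))‖ = 1 := by
  rw [mul_comm, Complex.norm_exp_ofReal_mul_I]

/-- A one-sided inverse is enough, so this also covers slices of a symbol, where f embeds ℝᵈ in ℝ²ᵈ.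
-/
theorem hasCompactSupport_comp_of_leftInverse {V E F : Type*} [TopologicalSpace V] [R1Space V]
    [TopologicalSpace E] [Zero F] {a : E → F} (hac : HasCompactSupport a) {f : V → E} {g : E → V}
    (hg : Continuous g) (hgf : Function.LeftInverse g f) : HasCompactSupport fun v => a (f v) := by
  refine HasCompactSupport.intro (hac.isCompact.image hg) fun v hv => ?_
  by_contra hne
  exact hv ⟨f v, subset_tsupport a hne, hgf v⟩

/-- Peetre's inequality: it trades decay in t − s for decay in t, at the cost of powers of s. -/
theorem one_add_norm_pow_le_mul {V : Type*} [SeminormedAddCommGroup V] (t s : V) (n : ℕ) :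
    (1 + ‖t‖) ^ n ≤ (1 + ‖t - s‖) ^ n * (1 + ‖s‖) ^ n := by
  rw [← mul_pow]
  have h : ‖t‖ ≤ ‖t - s‖ + ‖s‖ := by simpa using norm_add_le (t - s) s
  gcongr
  nlinarith [norm_nonneg (t - s), norm_nonneg s]

/-! ### The packet integral: decay in t -/

/-- The integrand of the Weyl quantization acting on a Gaussian wave packet, in the coordinates
centred at the packet. -/
noncomputable def packetIntegrand {d : ℕ} (a : Rd d × Rd d → ℂ) (h : ℝ) (x ξ t : Rd d)
    (p : Rd d × Rd d) : ℂ :=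
  Complex.exp (Complex.I * ((inner ℝ (t - p.1) p.2 : ℝ) : ℂ)) *
    a (x + (h / 2) • (t + p.1), ξ + h • p.2) * gaussian d p.1

variable {d : ℕ} {a : Rd d × Rd d → ℂ}

theorem integrable_packetIntegrand (ha : ContDiff ℝ ∞ a) (hac : HasCompactSupport a) {h : ℝ}
    (hh : 0 < h) (x ξ t : Rd d) : Integrable (packetIntegrand a h x ξ t) := by
  have hG := (contDiff_gaussian d).continuous
  have hA := ha.continuous
  refine Continuous.integrable_of_hasCompactSupport ?_ ?_
  · unfold packetIntegrand
    fun_prop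
  · have hc : HasCompactSupport fun p : Rd d × Rd d =>
        a (x + (h / 2) • (t + p.1), ξ + h • p.2) := by
      refine hasCompactSupport_comp_of_leftInverse hac
        (f := fun p : Rd d × Rd d => (x + (h / 2) • (t + p.1), ξ + h • p.2))
        (g := fun q : Rd d × Rd d => ((h / 2)⁻¹ • (q.1 - x) - t, h⁻¹ • (q.2 - ξ)))
        (by fun_prop) fun p => ?_
      ext1
      · simp [smul_smul, hh.ne']
      · simp [smul_smul, hh.ne']
    exact (hc.mul_left).mul_right

/-- The integral over the frequency variable decays rapidly. -/
theorem one_add_norm_pow_mul_norm_integral_frequency_le (ha : ContDiff ℝ ∞ a)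
    (hac : HasCompactSupport a) (n : ℕ) :
    ∃ C : ℝ, 0 ≤ C ∧ ∀ h : ℝ, 0 < h → h ≤ 1 → ∀ X ξ w : Rd d,
      (1 + ‖w‖) ^ n * ‖∫ θ, Complex.exp (Complex.I * ((inner ℝ w θ : ℝ) : ℂ)) * a (X, ξ + h • θ)‖ ≤
        C * (h ^ d)⁻¹ := by
  obtain ⟨C, hC, hosc⟩ := one_add_norm_pow_mul_norm_integral_exp_le d n
  obtain ⟨M, hM, hdec⟩ := norm_iteratedFDeriv_le_of_hasCompactSupport ha hac n (d + 1)
  refine ⟨C * (M * ∫ v : Rd d, ((1 + ‖v‖) ^ (d + 1))⁻¹), by positivity, ?_⟩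
  intro h hh hh1 X ξ w
  set T : Rd d →L[ℝ] Rd d × Rd d := h • ContinuousLinearMap.inr ℝ (Rd d) (Rd d) with hTdef
  have hT : ‖T‖ ≤ 1 := by
    rw [hTdef, norm_smul, Real.norm_of_nonneg hh.le]
    exact mul_le_one₀ hh1 (norm_nonneg _) (ContinuousLinearMap.norm_inr_le_one ℝ _ _)
  have hTe : ∀ θ : Rd d, (X, ξ + h • θ) = (X, ξ) + T θ := by
    intro θ; simp [hTdef]
  have hf : ContDiff ℝ ∞ fun θ : Rd d => a (X, ξ + h • θ) := by
    simp_rw [hTe]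
    exact ha.comp (contDiff_const.add T.contDiff)
  have hfc : HasCompactSupport fun θ : Rd d => a (X, ξ + h • θ) := by
    refine hasCompactSupport_comp_of_leftInverse hac (f := fun θ : Rd d => (X, ξ + h • θ))
      (g := fun q => h⁻¹ • (q.2 - ξ)) (by fun_prop) fun θ => ?_
    simp [smul_smul, hh.ne']
  have hb := hosc _ hf hfc (M * ∫ θ : Rd d, ((1 + ‖ξ + h • θ‖) ^ (d + 1))⁻¹) (by
    intro j hj
    have hwt : Integrable fun θ : Rd d => ((1 + ‖ξ + h • θ‖) ^ (d + 1))⁻¹ :=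
      ((integrable_inv_one_add_norm_pow d).comp_add_left ξ).comp_smul hh.ne'
    rw [← integral_const_mul]
    refine integral_mono_of_nonneg (Filter.Eventually.of_forall fun θ => norm_nonneg _)
      (hwt.const_mul M) (Filter.Eventually.of_forall fun θ => ?_)
    simp only
    simp_rw [hTe]
    refine (norm_iteratedFDeriv_comp_add_le ha _ T hT j θ).trans ?_
    have h1 := hdec j hj ((X, ξ) + T θ)
    rw [← div_eq_mul_inv, le_div_iff₀ (by positivity), mul_comm]
    refine le_trans ?_ h1
    gcongr
    rw [← hTe]
    exact norm_snd_le (X, ξ + h • θ)) w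
  -- The only source of the loss h⁻ᵈ.
  have hscale : ∫ θ : Rd d, ((1 + ‖ξ + h • θ‖) ^ (d + 1))⁻¹ =
      (h ^ d)⁻¹ * ∫ v : Rd d, ((1 + ‖v‖) ^ (d + 1))⁻¹ := by
    rw [Measure.integral_comp_smul_of_nonneg volume
      (fun v : Rd d => ((1 + ‖ξ + v‖) ^ (d + 1))⁻¹) h (hR := hh.le),
      integral_add_left_eq_self (fun v : Rd d => ((1 + ‖v‖) ^ (d + 1))⁻¹) ξ]
    simp
  simp_rw [real_inner_comm w] at hb
  rw [hscale] at hb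
  calc _ ≤ _ := hb
    _ = _ := by ring

/-- Rapid decay away from the centre of the wave packet. -/
theorem one_add_norm_pow_mul_norm_integral_packetIntegrand_le (ha : ContDiff ℝ ∞ a)
    (hac : HasCompactSupport a) (n : ℕ) :
    ∃ C : ℝ, 0 ≤ C ∧ ∀ h : ℝ, 0 < h → h ≤ 1 → ∀ x ξ t : Rd d,
      (1 + ‖t‖) ^ n * ‖∫ p, packetIntegrand a h x ξ t p‖ ≤ C * (h ^ d)⁻¹ := by
  obtain ⟨C, hC, hfreq⟩ := one_add_norm_pow_mul_norm_integral_frequency_le ha hac n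
  -- n powers pay for Peetre's inequality, d + 1 for integrability in s.
  obtain ⟨M, hM, hgau⟩ := one_add_norm_pow_mul_norm_iteratedFDeriv_gaussian_le d 0 (n + (d + 1))
  refine ⟨C * M * ∫ v : Rd d, ((1 + ‖v‖) ^ (d + 1))⁻¹, by positivity, ?_⟩
  intro h hh hh1 x ξ t
  have hint := integrable_packetIntegrand ha hac hh x ξ t
  rw [Measure.volume_eq_prod] at hint ⊢
  rw [integral_prod _ hint, mul_comm, ← le_div_iff₀ (by positivity)]
  refine (norm_integral_le_of_norm_le
    (g := fun s : Rd d => C * (h ^ d)⁻¹ * M / (1 + ‖t‖) ^ n * ((1 + ‖s‖) ^ (d + 1))⁻¹)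
    ((integrable_inv_one_add_norm_pow d).const_mul _)
    (Filter.Eventually.of_forall fun s => ?_)).trans (le_of_eq ?_)
  · unfold packetIntegrand
    simp only
    rw [integral_mul_const, norm_mul, div_mul_eq_mul_div, le_div_iff₀ (by positivity),
      ← div_eq_mul_inv, le_div_iff₀ (by positivity)]
    have h1 := hfreq h hh hh1 (x + (h / 2) • (t + s)) ξ (t - s)
    have h2 := hgau 0 le_rfl s
    rw [norm_iteratedFDeriv_zero] at h2
    set Z := ‖∫ θ, Complex.exp (Complex.I * ((inner ℝ (t - s) θ : ℝ) : ℂ)) *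
      a (x + (h / 2) • (t + s), ξ + h • θ)‖
    calc Z * ‖gaussian d s‖ * (1 + ‖t‖) ^ n * (1 + ‖s‖) ^ (d + 1)
        ≤ Z * ‖gaussian d s‖ * ((1 + ‖t - s‖) ^ n * (1 + ‖s‖) ^ n) * (1 + ‖s‖) ^ (d + 1) := by
          gcongr
          exact one_add_norm_pow_le_mul t s n
      _ = ((1 + ‖t - s‖) ^ n * Z) * ((1 + ‖s‖) ^ (n + (d + 1)) * ‖gaussian d s‖) := by
          rw [pow_add _ n]; ring
      _ ≤ _ := by gcongr
  · rw [integral_const_mul]; ring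

/-! ### The packet integral: decay in the distance to the symbol -/

/-- The integral over the position variable decays rapidly in the frequency, and in any quantity
`Λ` that is controlled on the support of the symbol. -/
theorem pow_mul_norm_integral_position_le (ha : ContDiff ℝ ∞ a) (hac : HasCompactSupport a)
    (n m : ℕ) :
    ∃ C : ℝ, 0 ≤ C ∧ ∀ h : ℝ, 0 < h → h ≤ 1 → ∀ (x Y t w : Rd d) (L Λ : ℝ), 0 ≤ L → 0 < Λ →
      (∀ s, (x + (h / 2) • (t + s), Y) ∈ tsupport a → Λ ≤ L * (1 + ‖s‖)) →
      Λ ^ n * ((1 + ‖w‖) ^ m *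
        ‖∫ s, Complex.exp (Complex.I * ((inner ℝ s w : ℝ) : ℂ)) *
          (a (x + (h / 2) • (t + s), Y) * gaussian d s)‖) ≤ C * L ^ n := by
  obtain ⟨C, hC, hosc⟩ := one_add_norm_pow_mul_norm_integral_exp_le d m
  obtain ⟨M, hM, hdec⟩ := norm_iteratedFDeriv_le_of_hasCompactSupport ha hac m 0
  obtain ⟨G, hG, hgau⟩ := one_add_norm_pow_mul_norm_iteratedFDeriv_gaussian_le d m (n + (d + 1))
  refine ⟨C * (2 ^ m * M * G * ∫ v : Rd d, ((1 + ‖v‖) ^ (d + 1))⁻¹), by positivity, ?_⟩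
  intro h hh hh1 x Y t w L Λ hL hΛ hsupp
  set T : Rd d →L[ℝ] Rd d × Rd d := (h / 2) • ContinuousLinearMap.inl ℝ (Rd d) (Rd d) with hTdef
  have hT : ‖T‖ ≤ 1 := by
    rw [hTdef, norm_smul, Real.norm_of_nonneg (by positivity)]
    exact mul_le_one₀ (by linarith) (norm_nonneg _) (ContinuousLinearMap.norm_inl_le_one ℝ _ _)
  have hTe : ∀ s : Rd d, (x + (h / 2) • (t + s), Y) = (x + (h / 2) • t, Y) + T s := by
    intro s; simp [hTdef, add_assoc]
  have hf0 : ContDiff ℝ ∞ fun s : Rd d => a ((x + (h / 2) • t, Y) + T s) :=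
    ha.comp (contDiff_const.add T.contDiff)
  have hf : ContDiff ℝ ∞ fun s : Rd d => a ((x + (h / 2) • t, Y) + T s) * gaussian d s :=
    hf0.mul (contDiff_gaussian d)
  have hfc : HasCompactSupport fun s : Rd d => a ((x + (h / 2) • t, Y) + T s) * gaussian d s := by
    refine HasCompactSupport.mul_right ?_
    refine hasCompactSupport_comp_of_leftInverse hac
      (g := fun q => (h / 2)⁻¹ • (q.1 - x) - t) (by fun_prop) fun s => ?_
    rw [← hTe]
    simp [smul_smul, hh.ne']
  simp_rw [hTe] at hsupp ⊢
  have hder : ∀ j ≤ m, ∀ s,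
      Λ ^ n * ‖iteratedFDeriv ℝ j
        (fun s : Rd d => a ((x + (h / 2) • t, Y) + T s) * gaussian d s) s‖ ≤
        L ^ n * (2 ^ m * M * G) * ((1 + ‖s‖) ^ (d + 1))⁻¹ := by
    intro j hj s
    have hterm : ∀ i ∈ Finset.range (j + 1),
        Λ ^ n * ((j.choose i : ℝ) *
          ‖iteratedFDeriv ℝ i (fun s : Rd d => a ((x + (h / 2) • t, Y) + T s)) s‖ *
          ‖iteratedFDeriv ℝ (j - i) (gaussian d) s‖) ≤
        (j.choose i : ℝ) * (L ^ n * (M * G) * ((1 + ‖s‖) ^ (d + 1))⁻¹) := by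
      intro i hi
      rw [Finset.mem_range] at hi
      have h1 := norm_iteratedFDeriv_comp_add_le ha (x + (h / 2) • t, Y) T hT i s
      -- Off the support every derivative of a vanishes, so the control of Λ is needed only on it.
      by_cases hmem : (x + (h / 2) • t, Y) + T s ∈ tsupport a
      · have h2 := hdec i (by omega) ((x + (h / 2) • t, Y) + T s)
        rw [pow_zero, one_mul] at h2
        have h3 := hgau (j - i) (by omega) s
        have h4 : Λ ^ n ≤ L ^ n * (1 + ‖s‖) ^ n := by
          rw [← mul_pow]
          exact pow_le_pow_left₀ hΛ.le (hsupp s hmem) n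
        rw [← div_eq_mul_inv, ← mul_div_assoc, le_div_iff₀ (by positivity)]
        calc _ ≤ (L ^ n * (1 + ‖s‖) ^ n) * ((j.choose i : ℝ) * M *
                ‖iteratedFDeriv ℝ (j - i) (gaussian d) s‖) * (1 + ‖s‖) ^ (d + 1) := by
              gcongr
              exact h1.trans h2
          _ = (j.choose i : ℝ) * (L ^ n * (M * ((1 + ‖s‖) ^ (n + (d + 1)) *
                ‖iteratedFDeriv ℝ (j - i) (gaussian d) s‖))) := by
              rw [pow_add _ n]; ring
          _ ≤ _ := by gcongr
      · have h0 : iteratedFDeriv ℝ i a ((x + (h / 2) • t, Y) + T s) = 0 := by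
          by_contra hne
          exact hmem (support_iteratedFDeriv_subset i hne)
        rw [h0, norm_zero] at h1
        rw [le_antisymm h1 (norm_nonneg _), mul_zero, zero_mul, mul_zero]
        positivity
    calc _ ≤ Λ ^ n * ∑ i ∈ Finset.range (j + 1), (j.choose i : ℝ) *
            ‖iteratedFDeriv ℝ i (fun s : Rd d => a ((x + (h / 2) • t, Y) + T s)) s‖ *
            ‖iteratedFDeriv ℝ (j - i) (gaussian d) s‖ := by
          gcongr
          exact norm_iteratedFDeriv_mul_le (N := ∞) hf0 (contDiff_gaussian d) s
            (by exact_mod_cast le_top)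
      _ ≤ ∑ i ∈ Finset.range (j + 1),
            (j.choose i : ℝ) * (L ^ n * (M * G) * ((1 + ‖s‖) ^ (d + 1))⁻¹) := by
          rw [Finset.mul_sum]
          exact Finset.sum_le_sum hterm
      _ = 2 ^ j * (L ^ n * (M * G) * ((1 + ‖s‖) ^ (d + 1))⁻¹) := by
          rw [← Finset.sum_mul, ← Nat.cast_sum, Nat.sum_range_choose]
          push_cast; rfl
      _ ≤ 2 ^ m * (L ^ n * (M * G) * ((1 + ‖s‖) ^ (d + 1))⁻¹) := by
          gcongr
          norm_num
      _ = _ := by ring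
  have hb := hosc _ hf hfc
    ((Λ ^ n)⁻¹ * (L ^ n * (2 ^ m * M * G)) * ∫ v : Rd d, ((1 + ‖v‖) ^ (d + 1))⁻¹)
    (fun j hj => by
      rw [← integral_const_mul]
      refine integral_mono_of_nonneg (Filter.Eventually.of_forall fun θ => norm_nonneg _)
        ((integrable_inv_one_add_norm_pow d).const_mul _) (Filter.Eventually.of_forall fun s => ?_)
      simp only
      rw [mul_assoc, ← div_eq_inv_mul, le_div_iff₀ (by positivity), mul_comm]
      exact hder j hj s) w
  calc _ ≤ Λ ^ n * _ := mul_le_mul_of_nonneg_left hb (by positivity)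
    _ = _ := by field_simp


/-- Decay in any quantity `Λ` that is controlled on the support of the symbol. -/
theorem pow_mul_norm_integral_packetIntegrand_le (ha : ContDiff ℝ ∞ a) (hac : HasCompactSupport a)
    (n : ℕ) {c : ℝ} (hc : 0 ≤ c) :
    ∃ C : ℝ, 0 ≤ C ∧ ∀ h : ℝ, 0 < h → h ≤ 1 → ∀ (x ξ t : Rd d) (Λ : ℝ), 0 < Λ →
      (∀ s θ, (x + (h / 2) • (t + s), ξ + h • θ) ∈ tsupport a →
        Λ ≤ c * (1 + ‖t‖) * (1 + ‖s‖) * (1 + ‖θ‖)) →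
      Λ ^ n * ‖∫ p, packetIntegrand a h x ξ t p‖ ≤ C * (1 + ‖t‖) ^ n := by
  -- n powers of 1 + |θ| offset those in L = c(1+|t|)(1+|θ|); d + 1 give integrability in θ.
  obtain ⟨C, hC, hpos⟩ := pow_mul_norm_integral_position_le ha hac n (n + (d + 1))
  refine ⟨C * c ^ n * ∫ v : Rd d, ((1 + ‖v‖) ^ (d + 1))⁻¹, by positivity, ?_⟩
  intro h hh hh1 x ξ t Λ hΛ hsupp
  have hint := integrable_packetIntegrand ha hac hh x ξ t
  rw [Measure.volume_eq_prod] at hint ⊢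
  rw [integral_prod_symm _ hint, mul_comm, ← le_div_iff₀ (by positivity)]
  refine (norm_integral_le_of_norm_le
    (g := fun θ : Rd d => C * c ^ n * (1 + ‖t‖) ^ n / Λ ^ n * ((1 + ‖θ‖) ^ (d + 1))⁻¹)
    ((integrable_inv_one_add_norm_pow d).const_mul _)
    (Filter.Eventually.of_forall fun θ => ?_)).trans (le_of_eq ?_)
  · have hphase : ∫ s, packetIntegrand a h x ξ t (s, θ) =
        Complex.exp (Complex.I * ((inner ℝ t θ : ℝ) : ℂ)) *
          ∫ s, Complex.exp (Complex.I * ((inner ℝ s (-θ) : ℝ) : ℂ)) *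
            (a (x + (h / 2) • (t + s), ξ + h • θ) * gaussian d s) := by
      rw [← integral_const_mul]
      congr 1
      funext s
      unfold packetIntegrand
      simp only
      rw [← mul_assoc, ← mul_assoc, ← Complex.exp_add, inner_sub_left, inner_neg_right]
      congr 3
      push_cast; ring
    rw [hphase, norm_mul, norm_exp_I_mul_ofReal, one_mul, ← div_eq_mul_inv,
      le_div_iff₀ (by positivity), le_div_iff₀ (by positivity)]
    have h1 := hpos h hh hh1 x (ξ + h • θ) t (-θ) (c * (1 + ‖t‖) * (1 + ‖θ‖)) Λ (by positivity) hΛ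
      (fun s hs => (hsupp s θ hs).trans (le_of_eq (by ring)))
    rw [norm_neg] at h1
    set Z := ‖∫ s, Complex.exp (Complex.I * ((inner ℝ s (-θ) : ℝ) : ℂ)) *
            (a (x + (h / 2) • (t + s), ξ + h • θ) * gaussian d s)‖
    refine le_of_mul_le_mul_right ?_ (show 0 < (1 + ‖θ‖) ^ n by positivity)
    calc _ = Λ ^ n * ((1 + ‖θ‖) ^ (n + (d + 1)) * Z) := by rw [pow_add]; ring
      _ ≤ _ := h1
      _ = _ := by rw [mul_pow, mul_pow]; ring
  · rw [integral_const_mul]; ring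

/-! ### Reduction to the packet integral -/

/-- The Weyl quantization acting on a wave packet, up to a phase and a shift. -/
theorem norm_weyl_packet (a : Rd d × Rd d → ℂ) {h : ℝ} (hh : 0 < h) (x ξ y : Rd d) :
    ‖weyl (dilate h a) (translate (h⁻¹ • x) (modulate (h⁻¹ • ξ) (gaussian d))) y‖ =
      ((2 * Real.pi) ^ d)⁻¹ * ‖∫ p, packetIntegrand a h x ξ (y - h⁻¹ • x) p‖ := by
  unfold weyl quantize
  have : (volume : Measure (Rd d × Rd d)).IsAddRightInvariant :=
    inferInstanceAs ((volume : Measure (Rd d)).prod (volume : Measure (Rd d))).IsAddRightInvariant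
  rw [← integral_add_right_eq_self _ ((h⁻¹ • x, h⁻¹ • ξ) : Rd d × Rd d)]
  set t := y - h⁻¹ • x with ht
  have hy : y = t + h⁻¹ • x := by rw [ht]; abel
  have : ∀ p : Rd d × Rd d,
      Complex.exp (Complex.I * ((inner ℝ (y - (p + (h⁻¹ • x, h⁻¹ • ξ)).1)
          (p + (h⁻¹ • x, h⁻¹ • ξ)).2 : ℝ) : ℂ)) *
        dilate h a ((1 / 2 : ℝ) • y + (1 - 1 / 2 : ℝ) • (p + (h⁻¹ • x, h⁻¹ • ξ)).1,
          (p + (h⁻¹ • x, h⁻¹ • ξ)).2) *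
        translate (h⁻¹ • x) (modulate (h⁻¹ • ξ) (gaussian d)) (p + (h⁻¹ • x, h⁻¹ • ξ)).1 =
      Complex.exp (Complex.I * ((inner ℝ t (h⁻¹ • ξ) : ℝ) : ℂ)) * packetIntegrand a h x ξ t p := by
    rintro ⟨s, θ⟩
    simp only [dilate, translate, modulate, packetIntegrand, Prod.mk_add_mk, Prod.smul_mk,
      add_sub_cancel_right]
    have e1 : h • ((1 / 2 : ℝ) • y + (1 - 1 / 2 : ℝ) • (s + h⁻¹ • x)) =
        x + (h / 2) • (t + s) := by
      rw [hy]
      simp only [smul_add, smul_smul]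
      match_scalars <;> field_simp <;> ring
    have e2 : h • (θ + h⁻¹ • ξ) = ξ + h • θ := by
      rw [smul_add, smul_smul, mul_inv_cancel₀ hh.ne', one_smul, add_comm]
    have e3 : y - (s + h⁻¹ • x) = t - s := by rw [ht]; abel
    rw [e1, e2, e3]
    have e4 : Complex.exp (Complex.I * ((inner ℝ (t - s) (θ + h⁻¹ • ξ) : ℝ) : ℂ)) *
        Complex.exp (Complex.I * ((inner ℝ s (h⁻¹ • ξ) : ℝ) : ℂ)) =
        Complex.exp (Complex.I * ((inner ℝ t (h⁻¹ • ξ) : ℝ) : ℂ)) *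
        Complex.exp (Complex.I * ((inner ℝ (t - s) θ : ℝ) : ℂ)) := by
      rw [← Complex.exp_add, ← Complex.exp_add]
      congr 1
      rw [inner_add_right, inner_sub_left t s (h⁻¹ • ξ)]
      push_cast; ring
    linear_combination (a (x + (h / 2) • (t + s), ξ + h • θ) * gaussian d s) * e4
  simp_rw [this]
  rw [integral_const_mul, norm_mul, norm_mul, norm_exp_I_mul_ofReal, one_mul, norm_inv,
    Complex.norm_real, Real.norm_of_nonneg (by positivity)]

theorem aestronglyMeasurable_weyl {b : Rd d × Rd d → ℂ} {u : Rd d → ℂ} (hb : Continuous b)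
    (hu : Continuous u) : AEStronglyMeasurable (weyl b u) volume := by
  unfold weyl quantize
  refine StronglyMeasurable.aestronglyMeasurable (StronglyMeasurable.const_mul ?_ _)
  refine StronglyMeasurable.integral_prod_right' (ν := volume)
    (f := fun q : Rd d × (Rd d × Rd d) =>
      Complex.exp (Complex.I * ((inner ℝ (q.1 - q.2.1) q.2.2 : ℝ) : ℂ)) *
        b ((1 / 2 : ℝ) • q.1 + (1 - 1 / 2 : ℝ) • q.2.1, q.2.2) * u q.2.1) ?_
  refine Continuous.stronglyMeasurable ?_
  fun_prop

/-! ### Separation of packet and symbol -/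

theorem one_le_bracket (x ξ : Rd d) : 1 ≤ bracket x ξ := by
  unfold bracket
  rw [Real.one_le_sqrt]
  nlinarith [sq_nonneg ‖x‖, sq_nonneg ‖ξ‖]

/-- On the support of the symbol, the distance of the packet to the symbol is controlled by the
relative coordinates. -/
theorem bracket_le_of_mem_ball {x₀ ξ₀ : Rd d} {ε : ℝ} (hε : 0 < ε) {x ξ : Rd d}
    (hx : ε ^ 2 ≤ ‖x - x₀‖ ^ 2 + ‖ξ - ξ₀‖ ^ 2) {h : ℝ} (hh : 0 < h) {t s θ : Rd d}
    (hmem : (x + (h / 2) • (t + s), ξ + h • θ) ∈ ball (ε / 4) x₀ ξ₀) :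
    bracket x ξ / h ≤ (2 * ((1 + ‖x₀‖ + ‖ξ₀‖) / ε + 1)) * 2 *
      (1 + ‖t‖) * (1 + ‖s‖) * (1 + ‖θ‖) := by
  have hball : Real.sqrt (‖x + (h / 2) • (t + s) - x₀‖ ^ 2 + ‖ξ + h • θ - ξ₀‖ ^ 2) < ε / 4 := hmem
  set K := (1 + ‖x₀‖ + ‖ξ₀‖) / ε with hK
  set D := ‖x - x₀‖ + ‖ξ - ξ₀‖ with hD
  have hDε : ε ≤ D := by
    refine le_of_sq_le_sq ?_ (by positivity)
    rw [hD]
    nlinarith [norm_nonneg (x - x₀), norm_nonneg (ξ - ξ₀),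
      mul_nonneg (norm_nonneg (x - x₀)) (norm_nonneg (ξ - ξ₀))]
  have hb1 : ‖x + (h / 2) • (t + s) - x₀‖ < ε / 4 :=
    (Real.le_sqrt_of_sq_le (by nlinarith [sq_nonneg ‖ξ + h • θ - ξ₀‖])).trans_lt hball
  have hb2 : ‖ξ + h • θ - ξ₀‖ < ε / 4 :=
    (Real.le_sqrt_of_sq_le
      (by nlinarith [sq_nonneg ‖x + (h / 2) • (t + s) - x₀‖])).trans_lt hball
  have h1 : ‖x - x₀‖ ≤ ε / 4 + h / 2 * (‖t‖ + ‖s‖) := by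
    have e : x - x₀ = (x + (h / 2) • (t + s) - x₀) - (h / 2) • (t + s) := by abel
    rw [e]
    refine (norm_sub_le _ _).trans ?_
    rw [norm_smul, Real.norm_of_nonneg (by positivity : 0 ≤ h / 2)]
    have := norm_add_le t s
    gcongr
  have h2 : ‖ξ - ξ₀‖ ≤ ε / 4 + h * ‖θ‖ := by
    have e : ξ - ξ₀ = (ξ + h • θ - ξ₀) - h • θ := by abel
    rw [e]
    refine (norm_sub_le _ _).trans ?_
    rw [norm_smul, Real.norm_of_nonneg hh.le]
    gcongr
  have hDle : D ≤ 2 * h * ((1 + ‖t‖) * (1 + ‖s‖) * (1 + ‖θ‖)) := by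
    -- D ≤ ε/2 + h((|t|+|s|)/2 + |θ|), and ε/2 ≤ D/2 is absorbed on the left.
    have h3 : D ≤ 2 * h * ((‖t‖ + ‖s‖) / 2 + ‖θ‖) := by rw [hD] at hDε ⊢; nlinarith
    refine h3.trans ?_
    have := norm_nonneg t; have := norm_nonneg s; have := norm_nonneg θ
    gcongr
    have : 0 ≤ ‖t‖ * ‖s‖ := by positivity
    have : 0 ≤ ‖t‖ * ‖θ‖ := by positivity
    have : 0 ≤ ‖s‖ * ‖θ‖ := by positivity
    have : 0 ≤ ‖t‖ * ‖s‖ * ‖θ‖ := by positivity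
    nlinarith
  -- ⟨(x,ξ)⟩ ≤ Kε + D and ε ≤ D.
  have hbr : bracket x ξ ≤ 2 * (K + 1) * D := by
    have h4 : bracket x ξ ≤ 1 + ‖x‖ + ‖ξ‖ := by
      unfold bracket
      refine Real.sqrt_le_iff.2 ⟨by positivity, ?_⟩
      have := norm_nonneg x; have := norm_nonneg ξ
      nlinarith [mul_nonneg (norm_nonneg x) (norm_nonneg ξ)]
    have h5 : ‖x‖ ≤ ‖x₀‖ + ‖x - x₀‖ := by simpa using norm_add_le x₀ (x - x₀)
    have h6 : ‖ξ‖ ≤ ‖ξ₀‖ + ‖ξ - ξ₀‖ := by simpa using norm_add_le ξ₀ (ξ - ξ₀)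
    have h7 : 1 + ‖x₀‖ + ‖ξ₀‖ = K * ε := by rw [hK]; field_simp
    have hK0 : 0 ≤ K := by positivity
    nlinarith [mul_le_mul_of_nonneg_left hDε hK0, mul_nonneg hK0 (hε.le.trans hDε)]
  rw [div_le_iff₀ hh]
  have hK0 : 0 ≤ K := by positivity
  calc _ ≤ _ := hbr
    _ ≤ 2 * (K + 1) * (2 * h * ((1 + ‖t‖) * (1 + ‖s‖) * (1 + ‖θ‖))) := by gcongr
    _ = _ := by ring

/-! ### Combining the two bounds -/

/-- Pointwise bound for the packet integral. -/
theorem norm_integral_packetIntegrand_sq_le {x₀ ξ₀ : Rd d} {ε : ℝ} (hε : 0 < ε)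
    (ha : ContDiff ℝ ∞ a) (hac : HasCompactSupport a) (hsupp : tsupport a ⊆ ball (ε / 4) x₀ ξ₀)
    (N : ℕ) :
    ∃ C : ℝ, 0 ≤ C ∧ ∀ x ξ : Rd d, ε ^ 2 ≤ ‖x - x₀‖ ^ 2 + ‖ξ - ξ₀‖ ^ 2 →
      ∀ h : ℝ, 0 < h → h ≤ 1 → ∀ t : Rd d,
        ‖∫ p, packetIntegrand a h x ξ t p‖ ^ 2 ≤
          C * h ^ (2 * N) * (bracket x ξ ^ N)⁻¹ * ((1 + ‖t‖) ^ (d + 1))⁻¹ := by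
  obtain ⟨C₁, hC₁, hdecay⟩ :=
    one_add_norm_pow_mul_norm_integral_packetIntegrand_le ha hac ((d + 2 * N) + (d + 1))
  obtain ⟨C₂, hC₂, hloc⟩ := pow_mul_norm_integral_packetIntegrand_le ha hac (d + 2 * N)
    (c := (2 * ((1 + ‖x₀‖ + ‖ξ₀‖) / ε + 1)) * 2) (by positivity)
  refine ⟨C₁ * C₂, by positivity, ?_⟩
  intro x ξ hx h hh hh1 t
  have hbr := one_le_bracket x ξ
  have hbr0 : 0 < bracket x ξ := by linarith
  have h1 := hdecay h hh hh1 x ξ t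
  have h2 := hloc h hh hh1 x ξ t (bracket x ξ / h) (by positivity)
    (fun s θ hm => bracket_le_of_mem_ball hε hx hh (hsupp hm))
  set B := ‖∫ p, packetIntegrand a h x ξ t p‖
  set T := 1 + ‖t‖ with hT
  have hT0 : 0 < T := by positivity
  -- The powers of 1 + |t| leave exponent −(d+1), and h^{d+2N}·h⁻ᵈ = h^{2N}.
  have h3 := mul_le_mul h1 h2 (by positivity) (by positivity)
  rw [← div_eq_mul_inv, ← div_eq_mul_inv, le_div_iff₀ (by positivity),
    le_div_iff₀ (by positivity)]
  have h4 : bracket x ξ ^ N ≤ bracket x ξ ^ (d + 2 * N) :=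
    pow_le_pow_right₀ hbr (by omega)
  rw [div_pow] at h3
  refine le_of_mul_le_mul_right ?_
    (show 0 < T ^ (d + 2 * N) * (h ^ (d + 2 * N))⁻¹ by positivity)
  calc B ^ 2 * T ^ (d + 1) * bracket x ξ ^ N * (T ^ (d + 2 * N) * (h ^ (d + 2 * N))⁻¹)
      ≤ B ^ 2 * T ^ (d + 1) * bracket x ξ ^ (d + 2 * N) *
          (T ^ (d + 2 * N) * (h ^ (d + 2 * N))⁻¹) := by gcongr
    _ = T ^ (d + 2 * N + (d + 1)) * B * (bracket x ξ ^ (d + 2 * N) / h ^ (d + 2 * N) * B) := by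
        rw [pow_add _ _ (d + 1)]; field_simp
    _ ≤ _ := h3
    _ = _ := by rw [pow_add h]; field_simp

end PhaseSpace

theorem lemma4p3 (d : ℕ) (x₀ ξ₀ : PhaseSpace.Rd d) (ε : ℝ) (hε : 0 < ε)
    (a : PhaseSpace.Rd d × PhaseSpace.Rd d → ℂ)
    (ha : ContDiff ℝ ∞ a) (hac : HasCompactSupport a)
    (hsupp : tsupport a ⊆ PhaseSpace.ball (ε / 4) x₀ ξ₀) (N : ℕ) :
    ∃ C : ℝ, 0 < C ∧
      ∀ x ξ : PhaseSpace.Rd d, ε ^ 2 ≤ ‖x - x₀‖ ^ 2 + ‖ξ - ξ₀‖ ^ 2 →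
        ∀ h : ℝ, 0 < h → h ≤ 1 →
          MemLp (PhaseSpace.weyl (PhaseSpace.dilate h a)
            (PhaseSpace.translate (h⁻¹ • x)
              (PhaseSpace.modulate (h⁻¹ • ξ) (PhaseSpace.gaussian d)))) 2 volume ∧
          (eLpNorm (PhaseSpace.weyl (PhaseSpace.dilate h a)
            (PhaseSpace.translate (h⁻¹ • x)
              (PhaseSpace.modulate (h⁻¹ • ξ) (PhaseSpace.gaussian d)))) 2 volume).toReal ^ 2
            ≤ C * h ^ (2 * N) * PhaseSpace.bracket x ξ ^ (-(N : ℤ)) := by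
  obtain ⟨C, hC, hbound⟩ := PhaseSpace.norm_integral_packetIntegrand_sq_le hε ha hac hsupp N
  set J : ℝ := ∫ v : PhaseSpace.Rd d, ((1 + ‖v‖) ^ (d + 1))⁻¹ with hJ
  have hJ0 : 0 ≤ J := integral_nonneg fun v => by positivity
  -- The summand 1 only makes the constant strictly positive.
  refine ⟨C * J + 1, by positivity, ?_⟩
  intro x ξ hx h hh hh1
  have hbr := PhaseSpace.one_le_bracket x ξ
  have hbr0 : 0 < PhaseSpace.bracket x ξ := by linarith
  set A := PhaseSpace.weyl (PhaseSpace.dilate h a) (PhaseSpace.translate (h⁻¹ • x)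
    (PhaseSpace.modulate (h⁻¹ • ξ) (PhaseSpace.gaussian d))) with hA
  have hmeas : AEStronglyMeasurable A volume := by
    have hG := (PhaseSpace.contDiff_gaussian d).continuous
    have hac := ha.continuous
    refine PhaseSpace.aestronglyMeasurable_weyl ?_ ?_
    · unfold PhaseSpace.dilate; fun_prop
    · unfold PhaseSpace.translate PhaseSpace.modulate; fun_prop
  set κ : ℝ := C * h ^ (2 * N) * (PhaseSpace.bracket x ξ ^ N)⁻¹ with hκ
  have hκ0 : 0 ≤ κ := by positivity
  have hpt : ∀ y, ‖A y‖ ^ 2 ≤ κ * ((1 + ‖y - h⁻¹ • x‖) ^ (d + 1))⁻¹ := by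
    intro y
    refine le_trans ?_ (hbound x ξ hx h hh hh1 (y - h⁻¹ • x))
    rw [hA, PhaseSpace.norm_weyl_packet a hh x ξ y]
    refine pow_le_pow_left₀ (by positivity) (mul_le_of_le_one_left (norm_nonneg _) ?_) 2
    exact inv_le_one_of_one_le₀ (one_le_pow₀ (by linarith [Real.two_le_pi]))
  have hdom : Integrable fun y => κ * ((1 + ‖y - h⁻¹ • x‖) ^ (d + 1))⁻¹ :=
    ((PhaseSpace.integrable_inv_one_add_norm_pow d).comp_sub_right (h⁻¹ • x)).const_mul κ
  have hsq : Integrable fun y => ‖A y‖ ^ 2 :=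
    hdom.mono' (hmeas.norm.pow 2) (Filter.Eventually.of_forall fun y => by
      rw [Real.norm_of_nonneg (by positivity)]; exact hpt y)
  have hmem : MemLp A 2 volume := (memLp_two_iff_integrable_sq_norm hmeas).2 hsq
  refine ⟨hmem, ?_⟩
  have hnorm : (eLpNorm A 2 volume).toReal ^ 2 = ∫ y, ‖A y‖ ^ 2 := by
    rw [hmem.eLpNorm_eq_integral_rpow_norm (by norm_num) (by norm_num),
      ENNReal.toReal_ofReal (by positivity)]
    simp only [ENNReal.toReal_ofNat, Real.rpow_ofNat]
    rw [← Real.rpow_natCast, ← Real.rpow_mul (integral_nonneg fun y => by positivity)]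
    norm_num
  rw [hnorm, zpow_neg, zpow_natCast]
  calc ∫ y, ‖A y‖ ^ 2 ≤ ∫ y, κ * ((1 + ‖y - h⁻¹ • x‖) ^ (d + 1))⁻¹ :=
        integral_mono hsq hdom hpt
    _ = κ * J := by
        rw [integral_const_mul, integral_sub_right_eq_self
          (fun v : PhaseSpace.Rd d => ((1 + ‖v‖) ^ (d + 1))⁻¹) (h⁻¹ • x)]
    _ = C * J * h ^ (2 * N) * (PhaseSpace.bracket x ξ ^ N)⁻¹ := by rw [hκ]; ring
    _ ≤ _ := by gcongr; linarith
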